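/- Consider the one-dimensional half-wave maps equation for functions $m(x,t)$ with values in the unit sphere $S^2\subset\mathbb{R}^3$, $$ m_t = m\times H m_x,\qquad (Hf)(x)=\frac1\pi\,\mathrm{P.V.}\!\int_{-\infty}^{\infty}\frac{f(y)}{y-x}\,dy $$ (equivalently, after replacing $m$ by $-m$, $m_t=m\times|\nabla|m$). Let $m$ be a classical solution for $t\ge 0$ which is a rational two-soliton solution, that is, $$ m(x,t)=m_0+i\sum_{j=1}^{2}\frac{s_j(t)}{x-x_j(t)}-i\sum_{j=1}^{2}\frac{\overline{s_j(t)}}{x-\overline{x_j(t)}},\qquad x\in\mathbb{R},\ t\ge 0, $$ where $m_0\in\mathbb{R}^3$, the spins $s_j(t)\in\mathbb{C}^3$ and the poles $x_j(t)\in\mathbb{C}$ are differentiable functions of $t\ge 0$, $s_j(t)\neq 0$, $x_1(t)\ne x_2(t)$, and $\mathrm{Im}\,x_j(t)>0$ for all $t\ge 0$ (the poles lie in the upper half-plane and never reach the real axis). Assume that the solution is non-degenerate: the asymptotic velocities $v_j=\lim_{t\to\infty}x_j(t)/t$ exist and $v_1\neq v_2$. Then $\mathrm{Im}\,x_1(t)$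 does not tend to $0$ as $t\to\infty$. Moreover, there is no infinite-time blow-up: for neither $j\in\{1,2\}$ is there a sequence $t_n\to\infty$ with $\mathrm{Im}\,x_j(t_n)\to 0$. Hence a blow-up caused by a pole approaching the real axis can only happen in finite time. -/

import Mathlib

open Filter Topology MeasureTheory

/-- `HasHilbertTransformAt f x L`: the principal value integral
`(Hf)(x) = (1/π) P.V. ∫ f(y) / (y - x) dy` exists and equals `L`. -/
def HasHilbertTransformAt (f : ℝ → ℝ) (x L : ℝ) : Prop :=
  (∀ ε : ℝ, 0 < ε → IntegrableOn (fun y => f y / (y - x)) {y : ℝ | ε ≤ |y - x|}) ∧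
    Tendsto (fun ε : ℝ => Real.pi⁻¹ * ∫ y in {y : ℝ | ε ≤ |y - x|}, f y / (y - x))
      (𝓝[>] 0) (𝓝 L)

/-- `m t x ∈ ℝ³` is, for times `t ≥ 0`, a classical solution of the half-wave maps equation
`m_t = m × H m_x` with values in the unit sphere of `ℝ³` (`H` acts on each component).
At `t = 0` the time derivative is one-sided. -/
structure IsHalfWaveMap (m : ℝ → ℝ → Fin 3 → ℝ) : Prop where
  sphere : ∀ t, 0 ≤ t → ∀ x, ∑ i, m t x i ^ 2 = 1
  space_diff : ∀ t, 0 ≤ t → Differentiable ℝ (m t)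
  equation : ∀ t, 0 ≤ t → ∀ x, ∃ h : Fin 3 → ℝ,
    (∀ i, HasHilbertTransformAt (deriv fun y => m t y i) x (h i)) ∧
      HasDerivWithinAt (fun τ => m τ x) (crossProduct (m t x) h) (Set.Ici 0) t

/-- The function `m` is, for times `t ≥ 0`, a rational `N`-soliton solution of the half-wave maps
equation, with background `m₀`, spins `s j` and poles `x j`:
`m(t,y) = m₀ + i ∑ⱼ sⱼ(t) / (y - xⱼ(t)) - i ∑ⱼ conj sⱼ(t) / (y - conj xⱼ(t))`,
where at each time the spins are non-zero and the poles are pairwise distinct points of the open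
upper half-plane (in particular no pole reaches the real axis). -/
structure IsSolitonSolution {N : ℕ} (m : ℝ → ℝ → Fin 3 → ℝ) (m₀ : Fin 3 → ℝ)
    (s : Fin N → ℝ → Fin 3 → ℂ) (x : Fin N → ℝ → ℂ) : Prop where
  halfWaveMap : IsHalfWaveMap m
  spin_diff : ∀ j, DifferentiableOn ℝ (s j) (Set.Ici 0)
  pole_diff : ∀ j, DifferentiableOn ℝ (x j) (Set.Ici 0)
  spin_ne_zero : ∀ j t, 0 ≤ t → s j t ≠ 0
  pole_ne : ∀ j k, j ≠ k → ∀ t, 0 ≤ t → x j t ≠ x k t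
  pole_im_pos : ∀ j t, 0 ≤ t → 0 < (x j t).im
  expansion : ∀ t, 0 ≤ t → ∀ (y : ℝ) (i : Fin 3),
    (m t y i : ℂ) = m₀ i + Complex.I * ∑ j, s j t i / (y - x j t)
      - Complex.I * ∑ j, (starRingEnd ℂ) (s j t i) / (y - (starRingEnd ℂ) (x j t))

/-- `v` is the asymptotic velocity of the pole `x`: `x(t) / t → v` as `t → ∞`. -/
def HasAsymptoticVelocity (x : ℝ → ℂ) (v : ℂ) : Prop :=
  Tendsto (fun t : ℝ => x t / t) atTop (𝓝 v)

/-- Infinite time blow-up through the pole `x`: its imaginary part tends to `0` along some sequence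
of times tending to infinity. -/
def InfiniteTimeBlowUp (x : ℝ → ℂ) : Prop :=
  ∃ τ : ℕ → ℝ, Tendsto τ atTop atTop ∧ Tendsto (fun n => (x (τ n)).im) atTop (𝓝 0)

/-! A pole can approach the real axis only if its spin dies, and the conservation laws forbid that.
Cancelling the simple pole of `∑ mᵢ² = 1` at `xⱼ` makes `|sⱼ|² / (2 Im xⱼ)` equal to the product of
`sⱼ` with the remaining regular part of `m`. Distinct velocities separate the poles, so for large
times with `Im xⱼ` small this gives `|sⱼ| ≤ C Im xⱼ` (`norm_spin_le`).

Cancelling the simple pole of the equation itself gives a closed spin dynamics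
(`hasDerivWithinAt_spin`), under which `s₁ + s₂` and `s₁ · s₂` are conserved. If `Im xⱼ(tₙ) → 0`,
then `sⱼ(tₙ) → 0` while the other spin stays bounded, hence `s₁ · s₂ = 0` at all times. The double
pole of `∑ mᵢ² = 1` makes the spins isotropic, and orthogonal isotropic vectors have zero cross
product. The spins are therefore constant, so `sⱼ = 0`, which is excluded. -/

/-! ### Hilbert transform of double poles -/

/-- A primitive of `y ↦ 1 / ((y - a) ^ 2 * (y - x))` on each side of `x`. -/
noncomputable def pvPrimitive (a : ℂ) (x y : ℝ) : ℂ :=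
  ((Real.log (y - x) : ℂ) - Complex.log (Complex.I * (y - a))) / (x - a) ^ 2
    + 1 / ((x - a) * (y - a))

lemma ofReal_sub_ne_zero {a : ℂ} (ha : a.im ≠ 0) (y : ℝ) : (y : ℂ) - a ≠ 0 := by
  intro h
  apply ha
  have := congrArg Complex.im h
  simpa using this

/-- Multiplication by `I` turns the line `y - a` into the right half-plane, where the principal
logarithm is smooth. -/
lemma I_mul_mem_slitPlane {a : ℂ} (ha : 0 < a.im) (y : ℝ) :
    Complex.I * (y - a) ∈ Complex.slitPlane := by
  left
  simpa using ha

lemma hasDerivAt_pvPrimitive {a : ℂ} (ha : 0 < a.im) {x y : ℝ} (hxy : y ≠ x) :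
    HasDerivAt (pvPrimitive a x) (1 / ((y - a) ^ 2 * (y - x))) y := by
  -- `Real.log` is `log |·|` on negative numbers, so one formula serves both sides of `x`.
  have h1 : HasDerivAt (fun y : ℝ => (Real.log (y - x) : ℂ)) ((1 / (y - x) : ℝ) : ℂ) y :=
    (((hasDerivAt_id y).sub_const x).log (sub_ne_zero.2 hxy)).ofReal_comp
  have h0 : HasDerivAt (fun y : ℝ => (y : ℂ) - a) 1 y :=
    ((hasDerivAt_id y).ofReal_comp).sub_const a
  have h2 : HasDerivAt (fun y : ℝ => Complex.log (Complex.I * (y - a)))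
      (Complex.I * 1 / (Complex.I * (y - a))) y :=
    (h0.const_mul Complex.I).clog_real (I_mul_mem_slitPlane ha y)
  have hya := ofReal_sub_ne_zero ha.ne' y
  have hxa := ofReal_sub_ne_zero ha.ne' x
  have hyx : (y : ℂ) - x ≠ 0 := by exact_mod_cast sub_ne_zero.2 hxy
  have h3 := ((h1.sub h2).div_const (((x : ℂ) - a) ^ 2)).add
    ((hasDerivAt_const y (1 : ℂ)).div (h0.const_mul ((x : ℂ) - a)) (mul_ne_zero hxa hya))
  refine h3.congr_deriv ?_
  push_cast
  field_simp
  ring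

/-- The real logarithms cancel at infinity and only the argument of `I * (y - a)` survives: `π/2` at
`+∞` and `-π/2` at `-∞`. This jump is the source of the multiplier `-i`. -/
lemma tendsto_pvPrimitive_atTop {a : ℂ} (ha : 0 < a.im) (x : ℝ) :
    Tendsto (pvPrimitive a x) atTop (𝓝 (-(Complex.I * Real.pi / 2) / (x - a) ^ 2)) := by
  have hinv : Tendsto (fun y : ℝ => ((y - x : ℝ) : ℂ)⁻¹) atTop (𝓝 0) := by
    have h : Tendsto (fun y : ℝ => (y - x)⁻¹) atTop (𝓝 0) :=
      tendsto_inv_atTop_zero.comp (tendsto_atTop_add_const_right _ (-x) tendsto_id)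
    simpa [Function.comp_def] using (Complex.continuous_ofReal.tendsto 0).comp h
  have hw : Tendsto (fun y : ℝ => Complex.I * (1 + (x - a) * ((y - x : ℝ) : ℂ)⁻¹)) atTop
      (𝓝 Complex.I) := by
    simpa using ((hinv.const_mul ((x : ℂ) - a)).const_add 1).const_mul Complex.I
  have hlog : Tendsto (fun y : ℝ => -Complex.log (Complex.I * (1 + (x - a) * ((y - x : ℝ) : ℂ)⁻¹)))
      atTop (𝓝 (-(Complex.I * Real.pi / 2))) := by
    have := (hw.clog (by simp [Complex.slitPlane])).neg
    rwa [Complex.log_I, show (Real.pi / 2 * Complex.I : ℂ) = Complex.I * Real.pi / 2 by ring] at this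
  have hrec : Tendsto (fun y : ℝ => ((y - x : ℝ) : ℂ)⁻¹ / ((x - a) *
      (1 + (x - a) * ((y - x : ℝ) : ℂ)⁻¹))) atTop (𝓝 0) := by
    have h1 := (((hinv.const_mul ((x : ℂ) - a)).const_add 1).const_mul ((x : ℂ) - a))
    have := hinv.div h1 (by simpa using ofReal_sub_ne_zero ha.ne' x)
    simpa [Pi.div_def] using this
  have := (hlog.div_const (((x : ℂ) - a) ^ 2)).add hrec
  rw [add_zero] at this
  refine this.congr' ?_
  filter_upwards [eventually_gt_atTop x] with y hy
  have hyx : (y : ℂ) - x ≠ 0 := by exact_mod_cast sub_ne_zero.2 hy.ne'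
  have hya := ofReal_sub_ne_zero ha.ne' y
  have hfac : Complex.I * ((y : ℂ) - a)
      = ((y - x : ℝ) : ℂ) * (Complex.I * (1 + (x - a) * ((y - x : ℝ) : ℂ)⁻¹)) := by
    push_cast
    field_simp
    ring
  have hne : Complex.I * (1 + (x - a) * ((y - x : ℝ) : ℂ)⁻¹) ≠ 0 := by
    intro h
    rw [h, mul_zero] at hfac
    exact mul_ne_zero Complex.I_ne_zero hya hfac
  have hsum : (1 + (x - a) * ((y - x : ℝ) : ℂ)⁻¹) = (y - a) / (y - x) := by
    push_cast
    field_simp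
    ring
  rw [pvPrimitive, hfac, Complex.log_ofReal_mul (sub_pos.2 hy) hne, hsum]
  congr 1
  · congr 1; ring
  · have hxa := ofReal_sub_ne_zero ha.ne' x
    push_cast
    field_simp

lemma tendsto_pvPrimitive_atBot {a : ℂ} (ha : 0 < a.im) (x : ℝ) :
    Tendsto (pvPrimitive a x) atBot (𝓝 ((Complex.I * Real.pi / 2) / (x - a) ^ 2)) := by
  have hinv : Tendsto (fun y : ℝ => ((x - y : ℝ) : ℂ)⁻¹) atBot (𝓝 0) := by
    have h : Tendsto (fun y : ℝ => (x - y)⁻¹) atBot (𝓝 0) :=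
      tendsto_inv_atTop_zero.comp (tendsto_atTop_add_const_left _ x tendsto_neg_atBot_atTop)
    simpa [Function.comp_def] using (Complex.continuous_ofReal.tendsto 0).comp h
  have hw : Tendsto (fun y : ℝ => Complex.I * (-1 + (x - a) * ((x - y : ℝ) : ℂ)⁻¹)) atBot
      (𝓝 (-Complex.I)) := by
    simpa using ((hinv.const_mul ((x : ℂ) - a)).const_add (-1)).const_mul Complex.I
  have hlog : Tendsto (fun y : ℝ => -Complex.log (Complex.I * (-1 + (x - a) * ((x - y : ℝ) : ℂ)⁻¹)))
      atBot (𝓝 (Complex.I * Real.pi / 2)) := by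
    have := (hw.clog (by simp [Complex.slitPlane])).neg
    rwa [Complex.log_neg_I, neg_mul, neg_neg,
      show (Real.pi / 2 * Complex.I : ℂ) = Complex.I * Real.pi / 2 by ring] at this
  have hrec : Tendsto (fun y : ℝ => ((x - y : ℝ) : ℂ)⁻¹ / ((x - a) *
      (-1 + (x - a) * ((x - y : ℝ) : ℂ)⁻¹))) atBot (𝓝 0) := by
    have h1 := (((hinv.const_mul ((x : ℂ) - a)).const_add (-1)).const_mul ((x : ℂ) - a))
    have := hinv.div h1 (by simpa [sub_eq_zero, eq_comm] using ofReal_sub_ne_zero ha.ne' x)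
    simpa [Pi.div_def] using this
  have := (hlog.div_const (((x : ℂ) - a) ^ 2)).add hrec
  rw [add_zero] at this
  refine this.congr' ?_
  filter_upwards [eventually_lt_atBot x] with y hy
  have hyx : (x : ℂ) - y ≠ 0 := by exact_mod_cast sub_ne_zero.2 hy.ne'
  have hya := ofReal_sub_ne_zero ha.ne' y
  have hfac : Complex.I * ((y : ℂ) - a)
      = ((x - y : ℝ) : ℂ) * (Complex.I * (-1 + (x - a) * ((x - y : ℝ) : ℂ)⁻¹)) := by
    push_cast
    field_simp
    ring
  have hne : Complex.I * (-1 + (x - a) * ((x - y : ℝ) : ℂ)⁻¹) ≠ 0 := by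
    intro h
    rw [h, mul_zero] at hfac
    exact mul_ne_zero Complex.I_ne_zero hya hfac
  have hsum : (-1 + (x - a) * ((x - y : ℝ) : ℂ)⁻¹) = (y - a) / (x - y) := by
    push_cast
    field_simp
    ring
  rw [pvPrimitive, hfac, Complex.log_ofReal_mul (sub_pos.2 hy) hne, hsum,
    ← Real.log_neg_eq_log, neg_sub]
  congr 1
  · congr 1; ring
  · have hxa := ofReal_sub_ne_zero ha.ne' x
    push_cast
    field_simp

/-- Symmetric truncation makes the two `log ε` terms cancel exactly; the rest is continuous at `x`.
-/
lemma tendsto_pvPrimitive_sub {a : ℂ} (ha : 0 < a.im) (x : ℝ) :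
    Tendsto (fun ε : ℝ => pvPrimitive a x (x - ε) - pvPrimitive a x (x + ε)) (𝓝[>] 0) (𝓝 0) := by
  have hne := ofReal_sub_ne_zero ha.ne' x
  have hc : ∀ σ : ℝ, Tendsto (fun ε : ℝ =>
      -Complex.log (Complex.I * ((x + σ * ε : ℝ) - a)) / (x - a) ^ 2
        + 1 / ((x - a) * ((x + σ * ε : ℝ) - a))) (𝓝[>] 0)
      (𝓝 (-Complex.log (Complex.I * ((x : ℝ) - a)) / (x - a) ^ 2
        + 1 / ((x - a) * (x - a)))) := by
    intro σ
    have h0 : Tendsto (fun ε : ℝ => (((x + σ * ε : ℝ) : ℂ) - a)) (𝓝[>] 0) (𝓝 (x - a)) := by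
      have : Continuous (fun ε : ℝ => (((x + σ * ε : ℝ) : ℂ) - a)) := by fun_prop
      simpa using (this.tendsto 0).mono_left nhdsWithin_le_nhds
    exact (((h0.const_mul _).clog (I_mul_mem_slitPlane ha x)).neg.div_const _).add
      (tendsto_const_nhds.div (h0.const_mul _) (mul_ne_zero hne hne))
  have := (hc (-1)).sub (hc 1)
  rw [sub_self] at this
  refine this.congr fun ε => ?_
  have e1 : Real.log (x - ε - x) = Real.log ε := by
    rw [show x - ε - x = -ε by ring, Real.log_neg_eq_log]
  have e2 : Real.log (x + ε - x) = Real.log ε := by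
    rw [show x + ε - x = ε by ring]
  rw [pvPrimitive, pvPrimitive, e1, e2, show x + -1 * ε = x - ε by ring, one_mul]
  ring

/-- The Hilbert transform multiplies rational functions with double poles in the upper half-plane
by `-i`. -/
lemma HasHilbertTransformAt.eq_of_double_poles {ι : Type*} [Fintype ι] {f : ℝ → ℝ} {x L : ℝ}
    (hL : HasHilbertTransformAt f x L) (a d : ι → ℂ) (ha : ∀ j, 0 < (a j).im)
    (hf : ∀ y : ℝ, f y = 2 * (∑ j, d j / (y - a j) ^ 2).re) :
    L = 2 * (∑ j, -Complex.I * d j / (x - a j) ^ 2).re := by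
  obtain ⟨hint, hlim⟩ := hL
  set R : ℝ → ℝ := fun y => 2 * (∑ j, d j * pvPrimitive (a j) x y).re with hR
  have hderiv : ∀ y, y ≠ x → HasDerivAt R (f y / (y - x)) y := by
    intro y hy
    have h1 : HasDerivAt (fun y => ∑ j, d j * pvPrimitive (a j) x y)
        (∑ j, d j * (1 / ((y - a j) ^ 2 * (y - x)))) y :=
      HasDerivAt.fun_sum fun j _ => (hasDerivAt_pvPrimitive (ha j) hy).const_mul (d j)
    have h2 := (Complex.reCLM.hasFDerivAt.comp_hasDerivAt y h1).const_mul (2 : ℝ)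
    refine h2.congr_deriv ?_
    have : ∑ j, d j * (1 / ((y - a j) ^ 2 * (y - x) : ℂ))
        = (∑ j, d j / (y - a j) ^ 2) * (((y - x)⁻¹ : ℝ) : ℂ) := by
      rw [Finset.sum_mul]
      refine Finset.sum_congr rfl fun j _ => ?_
      push_cast
      rw [one_div, mul_inv]
      ring
    rw [this, hf, Complex.reCLM_apply, Complex.re_mul_ofReal]
    ring
  have hre : ∀ {l : Filter ℝ} {u : ℝ → ι → ℂ} {w : ι → ℂ},
      (∀ j, Tendsto (fun y => u y j) l (𝓝 (w j))) →
      Tendsto (fun y => 2 * (∑ j, d j * u y j).re) l (𝓝 (2 * (∑ j, d j * w j).re)) := by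
    intro l u w h
    refine ((Complex.continuous_re.tendsto _).comp ?_).const_mul 2
    exact tendsto_finsetSum _ fun j _ => (h j).const_mul (d j)
  have htop := hre fun j => tendsto_pvPrimitive_atTop (ha j) x
  have hbot := hre fun j => tendsto_pvPrimitive_atBot (ha j) x
  have hmid := hre fun j => tendsto_pvPrimitive_sub (ha j) x
  have hval : ∀ ε : ℝ, 0 < ε → ∫ y in {y : ℝ | ε ≤ |y - x|}, f y / (y - x)
      = 2 * (∑ j, d j * (pvPrimitive (a j) x (x - ε) - pvPrimitive (a j) x (x + ε))).re
        + 2 * Real.pi * (∑ j, -Complex.I * d j / (x - a j) ^ 2).re := by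
    intro ε hε
    have hset : {y : ℝ | ε ≤ |y - x|} = Set.Iic (x - ε) ∪ Set.Ici (x + ε) := by
      ext y
      simp only [Set.mem_ofPred_eq, Set.mem_union, Set.mem_Iic, Set.mem_Ici, le_abs]
      constructor
      · rintro (h | h)
        · right; linarith
        · left; linarith
      · rintro (h | h)
        · right; linarith
        · left; linarith
    have hi := hint ε hε
    rw [hset] at hi ⊢
    have hi1 := hi.mono_set Set.subset_union_left
    have hi2 := hi.mono_set Set.subset_union_right
    rw [setIntegral_union (by
        rw [Set.disjoint_left]
        intro y h1 h2
        simp only [Set.mem_Iic, Set.mem_Ici] at h1 h2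
        linarith) measurableSet_Ici hi1 hi2, integral_Ici_eq_integral_Ioi,
      integral_Iic_of_hasDerivAt_of_tendsto' (fun y hy => hderiv y (by
        simp only [Set.mem_Iic] at hy; linarith)) hi1 hbot,
      integral_Ioi_of_hasDerivAt_of_tendsto' (fun y hy => hderiv y (by
        simp only [Set.mem_Ici] at hy; linarith)) (hi2.mono_set Set.Ioi_subset_Ici_self) htop]
    have hre' : 2 * Real.pi * (∑ j, -Complex.I * d j / (x - a j) ^ 2).re
        = 2 * (∑ j, (Real.pi : ℂ) * (-Complex.I * d j / (x - a j) ^ 2)).re := by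
      rw [← Finset.mul_sum, Complex.re_ofReal_mul]; ring
    have hsum : ∑ j, d j * ((pvPrimitive (a j) x (x - ε)) - pvPrimitive (a j) x (x + ε))
          + ∑ j, (Real.pi : ℂ) * (-Complex.I * d j / (x - a j) ^ 2)
        = ∑ j, d j * pvPrimitive (a j) x (x - ε)
            - ∑ j, d j * (Complex.I * Real.pi / 2 / (x - a j) ^ 2)
          + (∑ j, d j * (-(Complex.I * Real.pi / 2) / (x - a j) ^ 2)
            - ∑ j, d j * pvPrimitive (a j) x (x + ε)) := by
      rw [← Finset.sum_sub_distrib, ← Finset.sum_sub_distrib, ← Finset.sum_add_distrib,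
        ← Finset.sum_add_distrib]
      refine Finset.sum_congr rfl fun j _ => ?_
      ring
    have := congrArg Complex.re hsum
    simp only [Complex.add_re, Complex.sub_re] at this
    rw [hre']
    simp only [hR]
    linarith
  have hlim' := ((hmid.add_const
    (2 * Real.pi * (∑ j, -Complex.I * d j / (x - a j) ^ 2).re)).const_mul Real.pi⁻¹)
  have := tendsto_nhds_unique hlim (hlim'.congr' (by
    filter_upwards [self_mem_nhdsWithin] with ε hε
    rw [hval ε hε]))
  rw [this]
  have := Real.pi_ne_zero
  simp only [mul_zero, Finset.sum_const_zero, Complex.zero_re, zero_add]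
  field_simp

/-! ### Comparison of principal parts -/

/-- A holomorphic function on the complement of a closed countable set that vanishes on the real line
vanishes everywhere. -/
lemma eqOn_zero_compl_of_ofReal {S : Set ℂ} (hS : S.Countable) (hSc : IsClosed S)
    (hr : ∀ y : ℝ, (y : ℂ) ∉ S) {F : ℂ → ℂ} (hF : DifferentiableOn ℂ F Sᶜ)
    (h : ∀ y : ℝ, F y = 0) : Set.EqOn F 0 Sᶜ := by
  have hpre : IsPreconnected Sᶜ :=
    (hS.isPathConnected_compl_of_one_lt_rank (by
      rw [Complex.rank_real_complex]; norm_num)).isConnected.isPreconnected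
  refine (hF.analyticOnNhd hSc.isOpen_compl).eqOn_zero_of_preconnected_of_frequently_eq_zero
    hpre (hr 0) ?_
  have ht : Tendsto (fun y : ℝ => (y : ℂ)) (𝓝[≠] 0) (𝓝[≠] ((0 : ℝ) : ℂ)) := by
    refine tendsto_nhdsWithin_of_tendsto_nhds_of_eventually_within _
      ((Complex.continuous_ofReal.tendsto 0).mono_left nhdsWithin_le_nhds) ?_
    filter_upwards [self_mem_nhdsWithin] with y hy
    simpa using hy
  exact ht.frequently (Eventually.of_forall h).frequently

/-- Coefficients of order zero and one at `p` of a vanishing expansion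
`A + (z - p) B + (z - p)² C`. -/
lemma coeff_eq_zero_of_expansion {S : Set ℂ} (hS : S.Finite)
    (hr : ∀ y : ℝ, (y : ℂ) ∉ S) {p : ℂ} (hp : p ∉ S) {A B C : ℂ → ℂ} {A' : ℂ}
    (hA : DifferentiableOn ℂ A Sᶜ) (hB : DifferentiableOn ℂ B Sᶜ) (hC : DifferentiableOn ℂ C Sᶜ)
    (hA' : HasDerivAt A A' p)
    (h : ∀ y : ℝ, A y + (y - p) * B y + (y - p) ^ 2 * C y = 0) :
    A p = 0 ∧ A' + B p = 0 := by
  have hF : DifferentiableOn ℂ (fun z => A z + (z - p) * B z + (z - p) ^ 2 * C z) Sᶜ := by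
    fun_prop
  have hE := eqOn_zero_compl_of_ofReal hS.countable hS.isClosed hr hF h
  have hn : Sᶜ ∈ 𝓝 p := hS.isClosed.isOpen_compl.mem_nhds hp
  refine ⟨by simpa using hE hp, ?_⟩
  have hBp := (hB.differentiableAt hn).hasDerivAt
  have hCp := (hC.differentiableAt hn).hasDerivAt
  have hz : HasDerivAt (fun z : ℂ => z - p) 1 p := (hasDerivAt_id p).sub_const p
  have h1 := (hA'.add (hz.mul hBp)).add ((hz.pow 2).mul hCp)
  have h2 : HasDerivAt (fun z => A z + (z - p) * B z + (z - p) ^ 2 * C z) 0 p :=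
    (hasDerivAt_const p (0 : ℂ)).congr_of_eventuallyEq (by
      filter_upwards [hn] with z hz using hE hz)
  have := h1.unique h2
  simpa using this

/-- Vanishing of the pole of order two and one at `p` of a sum of squares that is constant on the
real line. -/
lemma isotropic_of_sum_sq_eq_one {S : Set ℂ} (hS : S.Finite)
    (hr : ∀ y : ℝ, (y : ℂ) ∉ S) {p : ℂ} (hp : p ∉ S) (hpr : ∀ y : ℝ, (y : ℂ) - p ≠ 0)
    (c : Fin 3 → ℂ) {M : Fin 3 → ℂ → ℂ} (hM : ∀ i, DifferentiableOn ℂ (M i) Sᶜ)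
    (h : ∀ y : ℝ, ∑ i, (Complex.I * (c i / (y - p)) + M i y) ^ 2 = 1) :
    ∑ i, c i ^ 2 = 0 ∧ ∑ i, c i * M i p = 0 := by
  have hM0 := hM 0
  have hM1 := hM 1
  have hM2 := hM 2
  -- The relation is multiplied by `(y - p)²`, with signs reversed. The double pole has a constant
  -- coefficient, so the order-one coefficient is just `B p`.
  have := coeff_eq_zero_of_expansion hS hr hp (A := fun _ => -∑ i, c i ^ 2)
    (B := fun z => 2 * Complex.I * ∑ i, c i * M i z) (C := fun z => (∑ i, M i z ^ 2) - 1)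
    (A' := 0) (by fun_prop) (by simp only [Fin.sum_univ_three]; fun_prop)
    (by simp only [Fin.sum_univ_three]; fun_prop) (hasDerivAt_const _ _) (by
      intro y
      have hy := hpr y
      have := h y
      simp only [Fin.sum_univ_three] at this ⊢
      field_simp at this
      linear_combination this
        - (c 0 ^ 2 + c 1 ^ 2 + c 2 ^ 2) * Complex.I_sq)
  simpa using this

/-- Comparison of the simple poles at `p` in one component of `m_t = m × H m_x`. -/
lemma simple_pole_eq {S : Set ℂ} (hS : S.Finite)
    (hr : ∀ y : ℝ, (y : ℂ) ∉ S) {p : ℂ} (hp : p ∉ S) (hpr : ∀ y : ℝ, (y : ℂ) - p ≠ 0)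
    {c₁ c₂ e f M₁' M₂' : ℂ} {M₁ M₂ N₁ N₂ U : ℂ → ℂ}
    (hM₁ : DifferentiableOn ℂ M₁ Sᶜ) (hM₂ : DifferentiableOn ℂ M₂ Sᶜ)
    (hN₁ : DifferentiableOn ℂ N₁ Sᶜ) (hN₂ : DifferentiableOn ℂ N₂ Sᶜ)
    (hU : DifferentiableOn ℂ U Sᶜ) (hM₁' : HasDerivAt M₁ M₁' p) (hM₂' : HasDerivAt M₂ M₂' p)
    (h : ∀ y : ℝ, Complex.I * (e / (y - p) + f / (y - p) ^ 2) + U y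
      = (Complex.I * (c₁ / (y - p)) + M₁ y) * (-(c₂ / (y - p) ^ 2) + N₂ y)
        - (Complex.I * (c₂ / (y - p)) + M₂ y) * (-(c₁ / (y - p) ^ 2) + N₁ y)) :
    Complex.I * e = Complex.I * (c₁ * N₂ p - c₂ * N₁ p) - (M₁' * c₂ - M₂' * c₁) := by
  have := coeff_eq_zero_of_expansion hS hr hp
    -- The triple poles cancel by antisymmetry of the cross product, so multiplication by `(y - p)²`
    -- already removes the singularity.
    (A := fun z => Complex.I * f + (M₁ z * c₂ - M₂ z * c₁))
    (B := fun z => Complex.I * e - Complex.I * (c₁ * N₂ z - c₂ * N₁ z))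
    (C := fun z => U z - (M₁ z * N₂ z - M₂ z * N₁ z))
    (by fun_prop) (by fun_prop) (by fun_prop)
    (((hM₁'.mul_const c₂).sub (hM₂'.mul_const c₁)).const_add _) (by
      intro y
      have hy := hpr y
      have := h y
      field_simp at this
      refine mul_left_cancel₀ hy ?_
      linear_combination this)
  linear_combination this.2

/-! ### Sums over poles -/

/-- The rational function `∑ₖ cₖ / (z - aₖ) ^ n`. -/
noncomputable def poleSum {ι : Type*} (T : Finset ι) (a c : ι → ℂ) (n : ℕ) (z : ℂ) : ℂ :=
  ∑ k ∈ T, c k / (z - a k) ^ n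

section poleSum

variable {ι : Type*} {T : Finset ι} {a c : ι → ℂ}

lemma hasDerivAt_poleSum_one {z : ℂ} (h : ∀ k ∈ T, z ≠ a k) :
    HasDerivAt (poleSum T a c 1) (-poleSum T a c 2 z) z := by
  have : HasDerivAt (fun z => ∑ k ∈ T, c k / (z - a k) ^ 1)
      (∑ k ∈ T, -(c k / (z - a k) ^ 2)) z := by
    refine HasDerivAt.fun_sum fun k hk => ?_
    have hz := sub_ne_zero.2 (h k hk)
    have := (hasDerivAt_const z (c k)).div (((hasDerivAt_id z).sub_const (a k)).pow 1)
      (pow_ne_zero 1 hz)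
    refine this.congr_deriv ?_
    simp [neg_div]
  rw [Finset.sum_neg_distrib] at this
  exact this

lemma differentiableOn_poleSum (n : ℕ) {S : Set ℂ} (h : ∀ k ∈ T, a k ∈ S) :
    DifferentiableOn ℂ (poleSum T a c n) Sᶜ := by
  unfold poleSum
  refine DifferentiableOn.fun_sum fun k hk => ?_
  refine (differentiableOn_const _).div (by fun_prop) fun z hz => pow_ne_zero n ?_
  exact sub_ne_zero.2 fun he => hz (he ▸ h k hk)

lemma poleSum_erase [DecidableEq ι] [Fintype ι] (j : ι) (n : ℕ) (z : ℂ) :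
    poleSum Finset.univ a c n z
      = c j / (z - a j) ^ n + poleSum (Finset.univ.erase j) a c n z :=
  (Finset.add_sum_erase _ _ (Finset.mem_univ j)).symm

lemma conj_poleSum (n : ℕ) (y : ℝ) :
    (starRingEnd ℂ) (poleSum T a c n y)
      = poleSum T (fun k => (starRingEnd ℂ) (a k)) (fun k => (starRingEnd ℂ) (c k)) n y := by
  simp [poleSum]

end poleSum

/-! ### Constraints and spin dynamics of solitons -/

namespace IsSolitonSolution

variable {N : ℕ} {m : ℝ → ℝ → Fin 3 → ℝ} {m₀ : Fin 3 → ℝ} {s : Fin N → ℝ → Fin 3 → ℂ}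
  {x : Fin N → ℝ → ℂ}

lemma eq_re (hm : IsSolitonSolution m m₀ s x) {t : ℝ} (ht : 0 ≤ t) (y : ℝ) (i : Fin 3) :
    m t y i = m₀ i + 2 * (Complex.I * ∑ k, s k t i / (y - x k t)).re := by
  have h := hm.expansion t ht y i
  have h2 : (Complex.I * ∑ j, (starRingEnd ℂ) (s j t i) / (y - (starRingEnd ℂ) (x j t)))
      = -(starRingEnd ℂ) (Complex.I * ∑ k, s k t i / (y - x k t)) := by
    simp
  rw [h2, sub_neg_eq_add, add_assoc, Complex.add_conj] at h
  exact_mod_cast h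

lemma ofReal_two_mul_re (w : ℂ) : ((2 * w.re : ℝ) : ℂ) = w + (starRingEnd ℂ) w :=
  (Complex.add_conj w).symm

lemma ofReal_ne_pole (hm : IsSolitonSolution m m₀ s x) {t : ℝ} (ht : 0 ≤ t) (k : Fin N) (y : ℝ) :
    (y : ℂ) - x k t ≠ 0 :=
  ofReal_sub_ne_zero (hm.pole_im_pos k t ht).ne' y

lemma hasDerivAt_space (hm : IsSolitonSolution m m₀ s x) {t : ℝ} (ht : 0 ≤ t) (y : ℝ)
    (i : Fin 3) :
    HasDerivAt (fun y => m t y i)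
      (2 * (∑ k, -Complex.I * s k t i / (y - x k t) ^ 2).re) y := by
  have h1 : HasDerivAt (fun y : ℝ => Complex.I * ∑ k, s k t i / ((y : ℂ) - x k t))
      (Complex.I * ∑ k, -(s k t i) / (y - x k t) ^ 2) y := by
    refine (HasDerivAt.fun_sum fun k _ => ?_).const_mul _
    have := (hasDerivAt_const y (s k t i)).div
      (((hasDerivAt_id y).ofReal_comp).sub_const (x k t)) (hm.ofReal_ne_pole ht k y)
    refine this.congr_deriv ?_
    simp
  have h2 := ((Complex.reCLM.hasFDerivAt.comp_hasDerivAt y h1).const_mul (2 : ℝ)).const_add (m₀ i)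
  have hfun : (fun y => m t y i) = fun y : ℝ => m₀ i + 2 * Complex.reCLM
      ((fun y : ℝ => Complex.I * ∑ k, s k t i / ((y : ℂ) - x k t)) y) := by
    funext y
    simpa using hm.eq_re ht y i
  rw [hfun]
  refine h2.congr_deriv ?_
  rw [Complex.reCLM_apply, Finset.mul_sum]
  congr 3
  funext k
  ring

/-- The Hilbert transform of the space derivative of a soliton solution. -/
lemma hilbert_eq (hm : IsSolitonSolution m m₀ s x) {t : ℝ} (ht : 0 ≤ t) (y : ℝ) (i : Fin 3)
    {L : ℝ} (hL : HasHilbertTransformAt (deriv fun y => m t y i) y L) :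
    (L : ℂ) = -poleSum Finset.univ (fun k => x k t) (fun k => s k t i) 2 y
      - poleSum Finset.univ (fun k => (starRingEnd ℂ) (x k t))
        (fun k => (starRingEnd ℂ) (s k t i)) 2 y := by
  have h := hL.eq_of_double_poles (fun k => x k t) (fun k => -Complex.I * s k t i)
    (fun k => hm.pole_im_pos k t ht) (fun y => (hm.hasDerivAt_space ht y i).deriv)
  have h2 : ∑ k, -Complex.I * (-Complex.I * s k t i) / ((y : ℂ) - x k t) ^ 2
      = -poleSum Finset.univ (fun k => x k t) (fun k => s k t i) 2 y := by
    rw [poleSum, ← Finset.sum_neg_distrib]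
    refine Finset.sum_congr rfl fun k _ => ?_
    linear_combination (s k t i / ((y : ℂ) - x k t) ^ 2) * Complex.I_sq
  rw [h, h2, ofReal_two_mul_re, map_neg, conj_poleSum]
  ring

/-- The time derivative of a soliton solution. -/
lemma hasDerivWithinAt_time (hm : IsSolitonSolution m m₀ s x) {t : ℝ} (ht : 0 ≤ t) (y : ℝ)
    (i : Fin 3) {s' : Fin N → Fin 3 → ℂ} {x' : Fin N → ℂ}
    (hs : ∀ k, HasDerivWithinAt (s k) (s' k) (Set.Ici 0) t)
    (hx : ∀ k, HasDerivWithinAt (x k) (x' k) (Set.Ici 0) t) :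
    HasDerivWithinAt (fun τ => m τ y i)
      (2 * (Complex.I * (poleSum Finset.univ (fun k => x k t) (fun k => s' k i) 1 y
        + poleSum Finset.univ (fun k => x k t) (fun k => s k t i * x' k) 2 y)).re)
      (Set.Ici 0) t := by
  have h1 : HasDerivWithinAt (fun τ : ℝ => Complex.I * ∑ k, s k τ i / ((y : ℂ) - x k τ))
      (Complex.I * (poleSum Finset.univ (fun k => x k t) (fun k => s' k i) 1 y
        + poleSum Finset.univ (fun k => x k t) (fun k => s k t i * x' k) 2 y)) (Set.Ici 0) t := by
    rw [poleSum, poleSum, ← Finset.sum_add_distrib]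
    refine (HasDerivWithinAt.fun_sum fun k _ => ?_).const_mul _
    have hne := hm.ofReal_ne_pole ht k y
    refine ((hasDerivWithinAt_pi.1 (hs k) i).div ((hx k).const_sub (y : ℂ)) hne).congr_deriv ?_
    field_simp
    ring
  have h2 := ((Complex.reCLM.hasFDerivAt.comp_hasDerivWithinAt t h1).const_mul
    (2 : ℝ)).const_add (m₀ i)
  exact h2.congr (fun τ hτ => by simpa using hm.eq_re hτ y i) (by simpa using hm.eq_re ht y i)

/-- The part of the solution that is regular at the pole `x j t`, continued to the plane. -/
noncomputable def regularPart (m₀ : Fin 3 → ℝ) (s : Fin N → ℝ → Fin 3 → ℂ) (x : Fin N → ℝ → ℂ)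
    (j : Fin N) (t : ℝ) (i : Fin 3) (z : ℂ) : ℂ :=
  m₀ i + Complex.I * poleSum (Finset.univ.erase j) (fun k => x k t) (fun k => s k t i) 1 z
    - Complex.I * poleSum Finset.univ (fun k => (starRingEnd ℂ) (x k t))
      (fun k => (starRingEnd ℂ) (s k t i)) 1 z

lemma eq_pole_add_regularPart (hm : IsSolitonSolution m m₀ s x) (j : Fin N) {t : ℝ} (ht : 0 ≤ t)
    (y : ℝ) (i : Fin 3) :
    (m t y i : ℂ) = Complex.I * (s j t i / (y - x j t)) + regularPart m₀ s x j t i y := by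
  have h := hm.expansion t ht y i
  have h2 := poleSum_erase (a := fun k => x k t) (c := fun k => s k t i) j 1 (y : ℂ)
  simp only [poleSum, pow_one] at h2
  rw [h, h2]
  simp only [regularPart, poleSum, pow_one]
  ring

/-- The singularities of the solution other than the pole `x j t`. -/
def otherPoles (x : Fin N → ℝ → ℂ) (j : Fin N) (t : ℝ) : Set ℂ :=
  (fun k => x k t) '' {k | k ≠ j} ∪ Set.range fun k => (starRingEnd ℂ) (x k t)

lemma finite_otherPoles (j : Fin N) (t : ℝ) : (otherPoles x j t).Finite :=
  (Set.toFinite _).union (Set.finite_range _)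

lemma ofReal_notMem_otherPoles (hm : IsSolitonSolution m m₀ s x) (j : Fin N) {t : ℝ} (ht : 0 ≤ t)
    (y : ℝ) : (y : ℂ) ∉ otherPoles x j t := by
  rintro (⟨k, -, h⟩ | ⟨k, h⟩)
  · exact hm.ofReal_ne_pole ht k y (sub_eq_zero.2 h.symm)
  · have := congrArg Complex.im h
    simp only [Complex.conj_im, Complex.ofReal_im] at this
    linarith [hm.pole_im_pos k t ht]

lemma pole_notMem_otherPoles (hm : IsSolitonSolution m m₀ s x) (j : Fin N) {t : ℝ} (ht : 0 ≤ t) :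
    x j t ∉ otherPoles x j t := by
  rintro (⟨k, hk, h⟩ | ⟨k, h⟩)
  · exact hm.pole_ne k j hk t ht h
  · have := congrArg Complex.im h
    simp only [Complex.conj_im] at this
    linarith [hm.pole_im_pos k t ht, hm.pole_im_pos j t ht]

lemma differentiableOn_poleSum_erase (j : Fin N) (t : ℝ) (c : Fin N → ℂ) (n : ℕ) :
    DifferentiableOn ℂ (poleSum (Finset.univ.erase j) (fun k => x k t) c n)
      (otherPoles x j t)ᶜ :=
  differentiableOn_poleSum n fun k hk => Or.inl ⟨k, Finset.ne_of_mem_erase hk, rfl⟩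

lemma differentiableOn_poleSum_conj (j : Fin N) (t : ℝ) (c : Fin N → ℂ) (n : ℕ) :
    DifferentiableOn ℂ (poleSum Finset.univ (fun k => (starRingEnd ℂ) (x k t)) c n)
      (otherPoles x j t)ᶜ :=
  differentiableOn_poleSum n fun k _ => Or.inr ⟨k, rfl⟩

lemma differentiableOn_regularPart (j : Fin N) (t : ℝ) (i : Fin 3) :
    DifferentiableOn ℂ (regularPart m₀ s x j t i) (otherPoles x j t)ᶜ :=
  (((differentiableOn_poleSum_erase j t _ 1).const_mul _).const_add _).sub
    ((differentiableOn_poleSum_conj j t _ 1).const_mul _)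

lemma hasDerivAt_regularPart (hm : IsSolitonSolution m m₀ s x) (j : Fin N) {t : ℝ} (ht : 0 ≤ t)
    (i : Fin 3) :
    HasDerivAt (regularPart m₀ s x j t i)
      (-(Complex.I * poleSum (Finset.univ.erase j) (fun k => x k t) (fun k => s k t i) 2 (x j t))
        + Complex.I * poleSum Finset.univ (fun k => (starRingEnd ℂ) (x k t))
          (fun k => (starRingEnd ℂ) (s k t i)) 2 (x j t)) (x j t) := by
  have hp := hm.pole_notMem_otherPoles j ht
  have h1 := hasDerivAt_poleSum_one (T := Finset.univ.erase j) (a := fun k => x k t)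
    (c := fun k => s k t i) (z := x j t)
    fun k hk h => hp (Or.inl ⟨k, Finset.ne_of_mem_erase hk, h.symm⟩)
  have h2 := hasDerivAt_poleSum_one (T := Finset.univ) (a := fun k => (starRingEnd ℂ) (x k t))
    (c := fun k => (starRingEnd ℂ) (s k t i)) (z := x j t)
    fun k _ h => hp (Or.inr ⟨k, h.symm⟩)
  refine (((h1.const_mul Complex.I).const_add (m₀ i : ℂ)).sub
    (h2.const_mul Complex.I)).congr_deriv ?_
  ring

/-- The constraints imposed on spins and poles by the values lying in the sphere. -/
theorem spin_constraints (hm : IsSolitonSolution m m₀ s x) (j : Fin N) {t : ℝ} (ht : 0 ≤ t) :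
    ∑ i, s j t i ^ 2 = 0 ∧ ∑ i, s j t i * regularPart m₀ s x j t i (x j t) = 0 := by
  refine isotropic_of_sum_sq_eq_one (finite_otherPoles j t) (hm.ofReal_notMem_otherPoles j ht)
    (hm.pole_notMem_otherPoles j ht) (hm.ofReal_ne_pole ht j) (s j t)
    (differentiableOn_regularPart j t) fun y => ?_
  simp only [← hm.eq_pole_add_regularPart j ht]
  exact_mod_cast hm.halfWaveMap.sphere t ht y

/-- The evolution of the spins: `ṡⱼ = -2 ∑_{k ≠ j} sⱼ × sₖ / (xⱼ - xₖ)²`. -/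
theorem hasDerivWithinAt_spin (hm : IsSolitonSolution m m₀ s x) (j : Fin N) {t : ℝ}
    (ht : 0 ≤ t) :
    HasDerivWithinAt (s j) ((-2 : ℂ) • crossProduct (s j t) fun i =>
      poleSum (Finset.univ.erase j) (fun k => x k t) (fun k => s k t i) 2 (x j t))
      (Set.Ici 0) t := by
  have hs : ∀ k, HasDerivWithinAt (s k) (derivWithin (s k) (Set.Ici 0) t) (Set.Ici 0) t :=
    fun k => (hm.spin_diff k t ht).hasDerivWithinAt
  have hx : ∀ k, HasDerivWithinAt (x k) (derivWithin (x k) (Set.Ici 0) t) (Set.Ici 0) t :=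
    fun k => (hm.pole_diff k t ht).hasDerivWithinAt
  set s' := fun k => derivWithin (s k) (Set.Ici 0) t
  set x' := fun k => derivWithin (x k) (Set.Ici 0) t
  refine (hs j).congr_deriv ?_
  have key : ∀ i : Fin 3, ∀ y : ℝ, ∃ h : Fin 3 → ℝ,
      (∀ l, (h l : ℂ) = -(s j t l / (y - x j t) ^ 2)
        + (-poleSum (Finset.univ.erase j) (fun k => x k t) (fun k => s k t l) 2 y
          - poleSum Finset.univ (fun k => (starRingEnd ℂ) (x k t))
            (fun k => (starRingEnd ℂ) (s k t l)) 2 y)) ∧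
      Complex.I * (s' j i / (y - x j t) + s j t i * x' j / (y - x j t) ^ 2)
        + (Complex.I * (poleSum (Finset.univ.erase j) (fun k => x k t) (fun k => s' k i) 1 y
          + poleSum (Finset.univ.erase j) (fun k => x k t) (fun k => s k t i * x' k) 2 y)
          - Complex.I * (poleSum Finset.univ (fun k => (starRingEnd ℂ) (x k t))
              (fun k => (starRingEnd ℂ) (s' k i)) 1 y
            + poleSum Finset.univ (fun k => (starRingEnd ℂ) (x k t))
              (fun k => (starRingEnd ℂ) (s k t i * x' k)) 2 y))
        = (crossProduct (m t y) h i : ℝ) := by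
    intro i y
    obtain ⟨h, hh, hd⟩ := hm.halfWaveMap.equation t ht y
    refine ⟨h, fun l => ?_, ?_⟩
    · rw [hm.hilbert_eq ht y l (hh l), poleSum_erase j]
      ring
    · have e := (uniqueDiffOn_Ici (0 : ℝ) t ht).eq_deriv _ (hasDerivWithinAt_pi.1 hd i)
        (hm.hasDerivWithinAt_time ht y i hs hx)
      rw [e, ofReal_two_mul_re, map_mul, map_add, conj_poleSum, conj_poleSum, Complex.conj_I,
        poleSum_erase (a := fun k => x k t) j 1, poleSum_erase (a := fun k => x k t) j 2]
      simp only [pow_one, s', x']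
      ring
  have comp : ∀ i i₁ i₂ : Fin 3,
      (∀ u w : Fin 3 → ℝ, crossProduct u w i = u i₁ * w i₂ - u i₂ * w i₁) →
      s' j i = -2 * (s j t i₁ * poleSum (Finset.univ.erase j) (fun k => x k t)
          (fun k => s k t i₂) 2 (x j t)
        - s j t i₂ * poleSum (Finset.univ.erase j) (fun k => x k t)
          (fun k => s k t i₁) 2 (x j t)) := by
    intro i i₁ i₂ hc
    have := simple_pole_eq (finite_otherPoles j t) (hm.ofReal_notMem_otherPoles j ht)
      (hm.pole_notMem_otherPoles j ht) (hm.ofReal_ne_pole ht j)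
      (differentiableOn_regularPart (m₀ := m₀) (s := s) j t i₁)
      (differentiableOn_regularPart (m₀ := m₀) (s := s) j t i₂)
      ((differentiableOn_poleSum_erase j t (fun k => s k t i₁) 2).neg.sub
        (differentiableOn_poleSum_conj j t (fun k => (starRingEnd ℂ) (s k t i₁)) 2))
      ((differentiableOn_poleSum_erase j t (fun k => s k t i₂) 2).neg.sub
        (differentiableOn_poleSum_conj j t (fun k => (starRingEnd ℂ) (s k t i₂)) 2))
      ((((differentiableOn_poleSum_erase j t (fun k => s' k i) 1).add
        (differentiableOn_poleSum_erase j t (fun k => s k t i * x' k) 2)).const_mul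
          Complex.I).sub
        (((differentiableOn_poleSum_conj j t (fun k => (starRingEnd ℂ) (s' k i)) 1).add
          (differentiableOn_poleSum_conj j t (fun k => (starRingEnd ℂ) (s k t i * x' k)) 2)).const_mul
            Complex.I))
      (hm.hasDerivAt_regularPart j ht i₁) (hm.hasDerivAt_regularPart j ht i₂)
      (c₁ := s j t i₁) (c₂ := s j t i₂) (e := s' j i) (f := s j t i * x' j) (by
        intro y
        obtain ⟨h, hh, hd⟩ := key i y
        rw [hc] at hd
        push_cast at hd
        rw [hh, hh, hm.eq_pole_add_regularPart j ht, hm.eq_pole_add_regularPart j ht] at hd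
        exact hd)
    refine mul_left_cancel₀ Complex.I_ne_zero ?_
    simp only [Pi.sub_apply, Pi.neg_apply] at this
    -- `H` multiplies upper and lower poles by opposite factors. Thus the lower-pole sums in `N` and
    -- in the derivative of the regular part cancel, while the upper-pole sums double, giving the
    -- factor `-2`.
    linear_combination this
  funext i
  fin_cases i
  · simpa [cross_apply] using comp 0 1 2 (by simp [cross_apply])
  · simpa [cross_apply] using comp 1 2 0 (by simp [cross_apply])
  · simpa [cross_apply] using comp 2 0 1 (by simp [cross_apply])

end IsSolitonSolution

/-! ### Isotropic vectors and auxiliary estimates -/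

/-- Lagrange's identity in two coordinates: `(u₁w₂ - u₂w₁)² = (u₁² + u₂²)(w₁² + w₂²) - (u₁w₁ +
u₂w₂)²`, which is `u₀²w₀² - (u₀w₀)² = 0` under the hypotheses. Each component is treated separately,
since over `ℂ` a vanishing sum of squares is not enough. -/
lemma crossProduct_eq_zero_of_isotropic {u w : Fin 3 → ℂ} (hu : ∑ i, u i ^ 2 = 0)
    (hw : ∑ i, w i ^ 2 = 0) (huw : ∑ i, u i * w i = 0) : crossProduct u w = 0 := by
  rw [Fin.sum_univ_three] at hu hw huw
  have h : ∀ a b : ℂ, (a - b) ^ 2 = 0 → a - b = 0 := fun a b => pow_eq_zero_iff two_ne_zero |>.1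
  funext i
  fin_cases i
  · simp only [cross_apply]
    apply h
    linear_combination hw * (u 1 ^ 2 + u 2 ^ 2) - w 0 ^ 2 * hu
      - (u 1 * w 1 + u 2 * w 2 - u 0 * w 0) * huw
  · simp only [cross_apply]
    apply h
    linear_combination hw * (u 0 ^ 2 + u 2 ^ 2) - w 1 ^ 2 * hu
      - (u 0 * w 0 + u 2 * w 2 - u 1 * w 1) * huw
  · simp only [cross_apply]
    apply h
    linear_combination hw * (u 0 ^ 2 + u 1 ^ 2) - w 2 ^ 2 * hu
      - (u 0 * w 0 + u 1 * w 1 - u 2 * w 2) * huw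

lemma eq_of_hasDerivWithinAt_zero {E : Type*} [NormedAddCommGroup E] [NormedSpace ℝ E]
    {f : ℝ → E} (h : ∀ t, 0 ≤ t → HasDerivWithinAt f 0 (Set.Ici 0) t) {t : ℝ} (ht : 0 ≤ t) :
    f t = f 0 := by
  have := (convex_Ici (0 : ℝ)).norm_image_sub_le_of_norm_hasDerivWithin_le (C := 0)
    (fun t ht => h t ht) (fun _ _ => by simp) (Set.mem_Ici.2 le_rfl) (Set.mem_Ici.2 ht)
  rw [zero_mul] at this
  exact sub_eq_zero.1 (norm_le_zero_iff.1 this)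

/-- Separation of the two poles thus also bounds the distance to the reflected pole from below. -/
lemma norm_sub_le_norm_sub_conj {z w : ℂ} (hz : 0 < z.im) (hw : 0 < w.im) :
    ‖z - w‖ ≤ ‖z - (starRingEnd ℂ) w‖ := by
  rw [← sq_le_sq₀ (norm_nonneg _) (norm_nonneg _), Complex.sq_norm, Complex.sq_norm,
    Complex.normSq_apply, Complex.normSq_apply]
  simp only [Complex.sub_re, Complex.sub_im, Complex.conj_re, Complex.conj_im]
  nlinarith [mul_pos hz hw]

/-- Poles with different asymptotic velocities separate. -/
lemma HasAsymptoticVelocity.tendsto_norm_sub {x y : ℝ → ℂ} {v w : ℂ}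
    (hx : HasAsymptoticVelocity x v) (hy : HasAsymptoticVelocity y w) (hne : v ≠ w) :
    Tendsto (fun t => ‖x t - y t‖) atTop atTop := by
  have h1 : Tendsto (fun t : ℝ => ‖x t / t - y t / t‖) atTop (𝓝 ‖v - w‖) := (hx.sub hy).norm
  refine (h1.pos_mul_atTop (norm_pos_iff.2 (sub_ne_zero.2 hne)) tendsto_id).congr' ?_
  filter_upwards [eventually_gt_atTop 0] with t ht
  rw [← sub_div, norm_div, Complex.norm_real, Real.norm_of_nonneg ht.le, id,
    div_mul_cancel₀ _ ht.ne']

/-! ### Two solitons: conservation laws and absence of blow-up -/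

namespace IsSolitonSolution

variable {m : ℝ → ℝ → Fin 3 → ℝ} {m₀ : Fin 3 → ℝ} {s : Fin 2 → ℝ → Fin 3 → ℂ}
  {x : Fin 2 → ℝ → ℂ}

lemma univ_erase_fin_two : ∀ {j k : Fin 2}, j ≠ k → Finset.univ.erase j = {k} := by decide

lemma hasDerivWithinAt_spin_two (hm : IsSolitonSolution m m₀ s x) {j k : Fin 2} (hjk : j ≠ k)
    {t : ℝ} (ht : 0 ≤ t) :
    HasDerivWithinAt (s j) ((-2 / (x j t - x k t) ^ 2) • crossProduct (s j t) (s k t))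
      (Set.Ici 0) t := by
  refine (hm.hasDerivWithinAt_spin j ht).congr_deriv ?_
  have h : (fun i => poleSum (Finset.univ.erase j) (fun k => x k t) (fun k => s k t i) 2 (x j t))
      = (1 / (x j t - x k t) ^ 2) • s k t := by
    funext i
    rw [univ_erase_fin_two hjk, poleSum, Finset.sum_singleton, Pi.smul_apply, smul_eq_mul]
    ring
  rw [h, map_smul, smul_smul]
  congr 1
  ring

/-- The total spin of a two-soliton solution is conserved. -/
lemma spin_add_eq (hm : IsSolitonSolution m m₀ s x) {j k : Fin 2} (hjk : j ≠ k)
    {t : ℝ} (ht : 0 ≤ t) : s j t + s k t = s j 0 + s k 0 := by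
  refine eq_of_hasDerivWithinAt_zero (f := s j + s k) (fun t ht => ?_) ht
  refine ((hm.hasDerivWithinAt_spin_two hjk ht).add
    (hm.hasDerivWithinAt_spin_two hjk.symm ht)).congr_deriv ?_
  -- The coefficient is symmetric in the two poles and the cross product antisymmetric.
  rw [← cross_anticomm (s j t) (s k t), smul_neg, ← sub_eq_add_neg, ← sub_smul,
    sub_sq_comm, sub_self, zero_smul]

/-- The product of the spins of a two-soliton solution is conserved. -/
lemma spin_dot_eq (hm : IsSolitonSolution m m₀ s x) {j k : Fin 2} (hjk : j ≠ k)
    {t : ℝ} (ht : 0 ≤ t) : ∑ i, s j t i * s k t i = ∑ i, s j 0 i * s k 0 i := by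
  refine eq_of_hasDerivWithinAt_zero (f := fun t => ∑ i, s j t i * s k t i) (fun t ht => ?_) ht
  have h1 := hasDerivWithinAt_pi.1 (hm.hasDerivWithinAt_spin_two hjk ht)
  have h2 := hasDerivWithinAt_pi.1 (hm.hasDerivWithinAt_spin_two hjk.symm ht)
  refine (HasDerivWithinAt.fun_sum fun i _ => (h1 i).mul (h2 i)).congr_deriv ?_
  -- Both terms are triple products with a repeated vector.
  simp only [Fin.sum_univ_three, cross_apply, Pi.smul_apply, smul_eq_mul]
  simp
  ring

/-- A pole close to the real axis and far from the other one has a small spin. -/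
lemma norm_spin_le (hm : IsSolitonSolution m m₀ s x) {j k : Fin 2} (hjk : j ≠ k) {t : ℝ}
    (ht : 0 ≤ t) (hfar : 1 ≤ ‖x j t - x k t‖) (hnear : (x j t).im ≤ 1 / 24) :
    ‖s j t‖ ≤ 12 * (x j t).im * (‖m₀‖ + 2 * ‖s j 0 + s k 0‖) := by
  set η := (x j t).im with hη
  have hη0 : 0 < η := hm.pole_im_pos j t ht
  have hfar' : 1 ≤ ‖x j t - (starRingEnd ℂ) (x k t)‖ :=
    hfar.trans (norm_sub_le_norm_sub_conj hη0 (hm.pole_im_pos k t ht))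
  have hk : ‖s k t‖ ≤ ‖s j 0 + s k 0‖ + ‖s j t‖ := by
    rw [← hm.spin_add_eq hjk ht]
    simpa using norm_sub_le (s j t + s k t) (s j t)
  -- The regular part at `x j t` without the term of the pole's own conjugate, which is singular as
  -- `η → 0`.
  set B : Fin 3 → ℂ := fun i => m₀ i + Complex.I * (s k t i / (x j t - x k t))
    - Complex.I * ((starRingEnd ℂ) (s k t i) / (x j t - (starRingEnd ℂ) (x k t))) with hB
  have hBle : ∀ i, ‖B i‖ ≤ ‖m₀‖ + 2 * ‖s k t‖ := by
    intro i
    have e0 : ‖(m₀ i : ℂ)‖ ≤ ‖m₀‖ := by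
      rw [Complex.norm_real]; exact norm_le_pi_norm m₀ i
    have e1 : ‖Complex.I * (s k t i / (x j t - x k t))‖ ≤ ‖s k t‖ := by
      rw [norm_mul, Complex.norm_I, one_mul, norm_div]
      exact (div_le_self (norm_nonneg _) hfar).trans (norm_le_pi_norm _ i)
    have e2 : ‖Complex.I * ((starRingEnd ℂ) (s k t i) / (x j t - (starRingEnd ℂ) (x k t)))‖
        ≤ ‖s k t‖ := by
      rw [norm_mul, Complex.norm_I, one_mul, norm_div, RCLike.norm_conj]
      exact (div_le_self (norm_nonneg _) hfar').trans (norm_le_pi_norm _ i)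
    calc ‖B i‖ ≤ _ := norm_sub_le _ _
      _ ≤ _ := add_le_add (norm_add_le _ _) le_rfl
      _ ≤ ‖m₀‖ + 2 * ‖s k t‖ := by linarith
  have hconj : x j t - (starRingEnd ℂ) (x j t) = 2 * η * Complex.I := by
    rw [Complex.sub_conj]; push_cast; ring
  have hηC : (η : ℂ) ≠ 0 := by exact_mod_cast hη0.ne'
  have hid : ((∑ i, ‖s j t i‖ ^ 2 : ℝ) : ℂ) = 2 * η * ∑ i, s j t i * B i := by
    have h := (hm.spin_constraints j ht).2
    have hreg : ∀ i, s j t i * regularPart m₀ s x j t i (x j t)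
        = s j t i * B i - (‖s j t i‖ ^ 2 : ℝ) / (2 * η) := by
      intro i
      have hp : poleSum Finset.univ (fun k => (starRingEnd ℂ) (x k t))
          (fun k => (starRingEnd ℂ) (s k t i)) 1 (x j t)
          = (starRingEnd ℂ) (s j t i) / (2 * η * Complex.I)
            + (starRingEnd ℂ) (s k t i) / (x j t - (starRingEnd ℂ) (x k t)) := by
        rw [poleSum_erase j, univ_erase_fin_two hjk, poleSum, Finset.sum_singleton, pow_one,
          pow_one, hconj]
      rw [regularPart, hp, univ_erase_fin_two hjk, poleSum, Finset.sum_singleton, pow_one, hB]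
      push_cast
      rw [← Complex.mul_conj']
      have := Complex.I_ne_zero
      field_simp
      ring
    simp only [hreg, Finset.sum_sub_distrib, ← Finset.sum_div] at h
    push_cast at h ⊢
    field_simp at h
    linear_combination -h
  -- The norm on `Fin 3 → ℂ` is the supremum norm; the factor 3 counts components.
  have hupper : ∑ i, ‖s j t i‖ ^ 2 ≤ 2 * η * (3 * (‖s j t‖ * (‖m₀‖ + 2 * ‖s k t‖))) := by
    have h := congrArg norm hid
    rw [Complex.norm_real, Real.norm_of_nonneg (by positivity), norm_mul, norm_mul,
      Complex.norm_real, Real.norm_of_nonneg hη0.le, Complex.norm_ofNat] at h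
    rw [h]
    refine mul_le_mul_of_nonneg_left ?_ (by positivity)
    refine (norm_sum_le _ _).trans ?_
    have : ∀ i ∈ (Finset.univ : Finset (Fin 3)),
        ‖s j t i * B i‖ ≤ ‖s j t‖ * (‖m₀‖ + 2 * ‖s k t‖) := fun i _ => by
      rw [norm_mul]
      exact mul_le_mul (norm_le_pi_norm _ i) (hBle i) (norm_nonneg _) (norm_nonneg _)
    simpa using Finset.sum_le_card_nsmul _ _ _ this
  have hlower : ‖s j t‖ ^ 2 ≤ ∑ i, ‖s j t i‖ ^ 2 := by
    rw [← Real.le_sqrt (norm_nonneg _) (by positivity),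
      pi_norm_le_iff_of_nonneg (Real.sqrt_nonneg _)]
    intro i
    refine Real.le_sqrt_of_sq_le ?_
    exact Finset.single_le_sum (f := fun i => ‖s j t i‖ ^ 2) (fun _ _ => by positivity)
      (Finset.mem_univ i)
  have hpos : 0 < ‖s j t‖ := norm_pos_iff.2 (hm.spin_ne_zero j t ht)
  have hmain : ‖s j t‖ ≤ 6 * η * (‖m₀‖ + 2 * ‖s k t‖) := by
    refine le_of_mul_le_mul_left ?_ hpos
    nlinarith [hlower, hupper]
  -- Bounding `s k` by the total spin and `s j` leaves `12 * η * ‖s j t‖`, at most half of `‖s j t‖`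
  -- as `η ≤ 1 / 24`. Absorbing it doubles 6 to 12.
  have h1 : η * ‖s k t‖ ≤ η * (‖s j 0 + s k 0‖ + ‖s j t‖) :=
    mul_le_mul_of_nonneg_left hk hη0.le
  have h2 : η * ‖s j t‖ ≤ 1 / 24 * ‖s j t‖ := mul_le_mul_of_nonneg_right hnear hpos.le
  linarith

/-- Non-degenerate two-soliton solutions do not blow up in infinite time. -/
theorem not_infiniteTimeBlowUp (hm : IsSolitonSolution m m₀ s x) {j k : Fin 2} (hjk : j ≠ k)
    {v : Fin 2 → ℂ} (hv : ∀ j, HasAsymptoticVelocity (x j) (v j)) (hne : v j ≠ v k) :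
    ¬ InfiniteTimeBlowUp (x j) := by
  rintro ⟨τ, hτ, him⟩
  have hτ0 : ∀ᶠ n in atTop, 0 ≤ τ n := hτ.eventually_ge_atTop 0
  have hs : Tendsto (fun n => s j (τ n)) atTop (𝓝 0) := by
    have hb : Tendsto (fun n => 12 * (x j (τ n)).im * (‖m₀‖ + 2 * ‖s j 0 + s k 0‖)) atTop
        (𝓝 0) := by
      simpa using (him.const_mul 12).mul_const (‖m₀‖ + 2 * ‖s j 0 + s k 0‖)
    refine squeeze_zero_norm' ?_ hb
    filter_upwards [hτ0, hτ.eventually (((hv j).tendsto_norm_sub (hv k) hne).eventually_ge_atTop 1),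
      him.eventually_le_const (show (0 : ℝ) < 1 / 24 by norm_num)] with n h0 h1 h2
    exact hm.norm_spin_le hjk h0 h1 h2
  have hdot : ∑ i, s j 0 i * s k 0 i = 0 := by
    -- By conservation of the total spin the other spin is the total minus `s j`, hence convergent
    -- along the sequence.
    have hlim : Tendsto (fun n => ∑ i, s j (τ n) i * (s j 0 + s k 0 - s j (τ n)) i) atTop
        (𝓝 (∑ i, (0 : Fin 3 → ℂ) i * (s j 0 + s k 0 - 0) i)) := by
      refine tendsto_finsetSum _ fun i _ => ?_
      exact (tendsto_pi_nhds.1 hs i).mul (tendsto_pi_nhds.1 (hs.const_sub _) i)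
    have hconst : Tendsto (fun n => ∑ i, s j (τ n) i * (s j 0 + s k 0 - s j (τ n)) i) atTop
        (𝓝 (∑ i, s j 0 i * s k 0 i)) := by
      refine tendsto_const_nhds.congr' ?_
      filter_upwards [hτ0] with n hn
      rw [← hm.spin_add_eq hjk hn, add_sub_cancel_left, hm.spin_dot_eq hjk hn]
    simpa using tendsto_nhds_unique hconst hlim
  have hconst : ∀ t, 0 ≤ t → s j t = s j 0 := fun t ht => by
    refine eq_of_hasDerivWithinAt_zero (fun t ht => ?_) ht
    refine (hm.hasDerivWithinAt_spin_two hjk ht).congr_deriv ?_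
    rw [crossProduct_eq_zero_of_isotropic (hm.spin_constraints j ht).1
      (hm.spin_constraints k ht).1 ((hm.spin_dot_eq hjk ht).trans hdot), smul_zero]
  refine hm.spin_ne_zero j 0 le_rfl (tendsto_nhds_unique (tendsto_const_nhds.congr' ?_) hs)
  filter_upwards [hτ0] with n hn
  rw [hconst _ hn]

end IsSolitonSolution

theorem mainTheorem1 (m : ℝ → ℝ → Fin 3 → ℝ) (m₀ : Fin 3 → ℝ)
    (s : Fin 2 → ℝ → Fin 3 → ℂ) (x : Fin 2 → ℝ → ℂ) (v : Fin 2 → ℂ)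
    (hm : IsSolitonSolution m m₀ s x)
    (hv : ∀ j, HasAsymptoticVelocity (x j) (v j))
    (hne : v 0 ≠ v 1) :
    ¬ Tendsto (fun t => (x 0 t).im) atTop (𝓝 0) ∧ ∀ j, ¬ InfiniteTimeBlowUp (x j) := by
  have h : ∀ j, ¬ InfiniteTimeBlowUp (x j) := by
    intro j
    fin_cases j
    · exact hm.not_infiniteTimeBlowUp (k := 1) (by decide) hv hne
    · exact hm.not_infiniteTimeBlowUp (k := 0) (by decide) hv hne.symm
  exact ⟨fun h0 => h 0 ⟨fun n => n, tendsto_natCast_atTop_atTop,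
    h0.comp tendsto_natCast_atTop_atTop⟩, h⟩
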